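/- All spaces are $T_1$. For a space $X$ let $k(X)$ be the least cardinal $m$ such that every open cover of $X$ has an open refinement of cardinality $<m$, and let $w(X)$ be the weight of $X$ (the least cardinality of a base). A subspace $F\subseteq X$ is *paracompact in* $X$ if for every family $\{W_\mu:\mu\in M\}$ of open subsets of $X$ with $F\subseteq\bigcup_\mu W_\mu$ there is a family $\{W'_\mu:\mu\in M\}$ of open subsets of $X$, locally finite in $X$, with $F\subseteq\bigcup_\mu W'_\mu$ and $W'_\mu\subseteq W_\mu$ for all $\mu\in M$. A cardinal $\tau$ is *sequential* if it is the supremum of a sequence of cardinals smaller than $\tau$ (for infinite $\tau$: if $\operatorname{cf}(\tau)=\aleph_0$; in particular $\aleph_0$ is sequential). A set-valued mapping $\theta:X\to Y$ assigns to every $x\in X$ a non-empty subset $\theta(x)$ of $Y$; its image is $\theta(X)=\bigcup_{x\in X}\theta(x)$; it is lower semi-continuous if $\{x\in X:\theta(x)\cap H\neq\emptyset\}$ is open in $X$ for every open $H\subseteq Y$, and closed-valued if every $\theta(x)$ is closed in $Y$. A (set-valued) selection of $\theta$ is a set-valued mapping $\phi:X\to Y$ with $\phi(x)\subseteq\theta(x)$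 for all $x$; a single-valued selection is a (not necessarily continuous) function $g:X\to Y$ with $g(x)\in\theta(x)$ for all $x$. **Theorem 2.7.** Let $X$ be a regular space, $F$ a subspace of $X$ that is paracompact in $X$, and $\tau$ an infinite cardinal, such that $k(F)\le\tau$ and $k(Y)<\tau$ for every closed subset $Y$ of $X$ with $Y\subseteq X\setminus F$. Then the following assertions K1–K8 are equivalent: - K1. $k(X)\le\tau$. - K2. Every lower semi-continuous closed-valued mapping $\theta:X\to Y$ into a completely metrizable space $Y$ has a lower semi-continuous selection $\phi:X\to Y$ with $k(\operatorname{cl}_Y\phi(X))\le\tau$. - K3. Every lower semi-continuous closed-valued mapping $\theta:X\to Y$ into a completely metrizable space $Y$ has a set-valued selection $g:X\to Y$ with $k(\operatorname{cl}_Y g(X))\le\tau$. - K4. Every lower semi-continuous closed-valued mapping $\theta:X\to Y$ into a completely metrizable space $Y$ has a single-valued selection $g:X\to Y$ with $k(\operatorname{cl}_Y g(X))\le\tau$. - K5. Every lower semi-continuous mapping $\theta:X\to Y$ into a discrete space $Y$ has a lower semi-continuous selection $\phi:X\to Y$ with $|\phi(X)|<\tau$. - K6. Every lower semi-continuous mapping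 $\theta:X\to Y$ into a discrete space $Y$ has a set-valued selection $g:X\to Y$ with $|g(X)|<\tau$. - K7. Every lower semi-continuous mapping $\theta:X\to Y$ into a discrete space $Y$ has a single-valued selection $g:X\to Y$ with $|g(X)|<\tau$. - K8. Every open cover of $X$ has a subcover of cardinality $<\tau$. Moreover, if $\tau$ is not sequential, then K1–K8 are also equivalent to - K11. Every lower semi-continuous closed-valued mapping $\theta:X\to Y$ into a completely metrizable space $Y$ has a lower semi-continuous selection $\phi:X\to Y$ with $w(\phi(X))<\tau$. -/

import Mathlib

open Set
open scoped Cardinal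

universe u

namespace Selections

/-- Every open cover of `X` has an open refinement (again a cover of `X`) of cardinality `< m`. -/
def HasSmallRefinements (X : Type u) [TopologicalSpace X] (m : Cardinal.{u}) : Prop :=
  ∀ γ : Set (Set X), (∀ U ∈ γ, IsOpen U) → ⋃₀ γ = univ →
    ∃ ξ : Set (Set X), (∀ V ∈ ξ, IsOpen V) ∧ ⋃₀ ξ = univ ∧
      (∀ V ∈ ξ, ∃ U ∈ γ, V ⊆ U) ∧ #ξ < m

/-- The degree of compactness `k(X)`: the least cardinal `m` such that every open cover of `X` has
an open refinement of cardinality `< m`. -/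
noncomputable def compactnessDegree (X : Type u) [TopologicalSpace X] : Cardinal.{u} :=
  sInf {m : Cardinal.{u} | HasSmallRefinements X m}

/-- The minimum in the definition of `k(X)` is attained, so that `k(X) ≤ τ` says that every open
cover of `X` has an open refinement of cardinality `< τ`. -/
theorem compactnessDegree_le_iff (X : Type u) [TopologicalSpace X] (τ : Cardinal.{u}) :
    compactnessDegree X ≤ τ ↔ HasSmallRefinements X τ := by
  have hne : {m : Cardinal.{u} | HasSmallRefinements X m}.Nonempty :=
    ⟨Order.succ #(Set X), fun γ h1 h2 =>
      ⟨γ, h1, h2, fun V hV => ⟨V, hV, Subset.rfl⟩, Order.lt_succ_of_le (Cardinal.mk_set_le γ)⟩⟩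
  refine ⟨fun h γ h1 h2 => ?_, fun h => csInf_le' h⟩
  obtain ⟨ξ, a, b, c, d⟩ := (csInf_mem hne : HasSmallRefinements X (compactnessDegree X)) γ h1 h2
  exact ⟨ξ, a, b, c, d.trans_le h⟩

/-- The weight `w(X)`: the least cardinality of a base of the topology of `X`. -/
noncomputable def weight (X : Type u) [TopologicalSpace X] : Cardinal.{u} :=
  sInf {m : Cardinal.{u} | ∃ B : Set (Set X), TopologicalSpace.IsTopologicalBasis B ∧ #B = m}

/-- The subspace `Z` is paracompact in `X`: every family of open subsets of `X` that covers `Z` can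
be shrunk, index by index, to a family of open subsets of `X` that is locally finite in `X` and
still covers `Z`. -/
def ParacompactIn {X : Type u} [TopologicalSpace X] (Z : Set X) : Prop :=
  ∀ (M : Type u) (W : M → Set X), (∀ μ, IsOpen (W μ)) → Z ⊆ ⋃ μ, W μ →
    ∃ W' : M → Set X, (∀ μ, IsOpen (W' μ)) ∧ LocallyFinite W' ∧ Z ⊆ ⋃ μ, W' μ ∧
      ∀ μ, W' μ ⊆ W μ

/-- A cardinal is sequential if it is the supremum of a sequence of strictly smaller cardinals.
Among the infinite cardinals these are the ones of countable cofinality, `ℵ₀` included. -/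
def IsSequential (τ : Cardinal.{u}) : Prop :=
  ∃ t : ℕ → Cardinal.{u}, (∀ n, t n < τ) ∧ IsLUB (range t) τ

/-- `θ` assigns a non-empty set to every point. -/
def IsSetValued {X Y : Type u} (θ : X → Set Y) : Prop :=
  ∀ x, (θ x).Nonempty

/-- `φ` is a (set-valued) selection of `θ`. -/
def IsSelection {X Y : Type u} (φ θ : X → Set Y) : Prop :=
  IsSetValued φ ∧ ∀ x, φ x ⊆ θ x

/-- The image `θ(X)` of the whole domain. -/
def image {X Y : Type u} (θ : X → Set Y) : Set Y :=
  ⋃ x, θ x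

/-- Lower semi-continuity: the inverse image `{x | θ(x) ∩ H ≠ ∅}` of every open set `H` is open. -/
def IsLSC {X Y : Type u} [TopologicalSpace X] [TopologicalSpace Y] (θ : X → Set Y) : Prop :=
  ∀ H : Set Y, IsOpen H → IsOpen {x | (θ x ∩ H).Nonempty}

/-- This is the notion of Mathlib. -/
theorem isLSC_iff_lowerHemicontinuous {X Y : Type u} [TopologicalSpace X] [TopologicalSpace Y]
    (θ : X → Set Y) : IsLSC θ ↔ LowerHemicontinuous θ :=
  lowerHemicontinuous_iff_isOpen_inter_nonempty.symm

section Properties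

variable (X : Type u) [TopologicalSpace X] (τ : Cardinal.{u})

def K1 : Prop := compactnessDegree X ≤ τ

def K2 : Prop :=
  ∀ (Y : Type u) [TopologicalSpace Y] [TopologicalSpace.IsCompletelyMetrizableSpace Y]
    (θ : X → Set Y), IsSetValued θ → IsLSC θ → (∀ x, IsClosed (θ x)) →
    ∃ φ : X → Set Y, IsSelection φ θ ∧ IsLSC φ ∧ compactnessDegree (closure (image φ)) ≤ τ

def K3 : Prop :=
  ∀ (Y : Type u) [TopologicalSpace Y] [TopologicalSpace.IsCompletelyMetrizableSpace Y]
    (θ : X → Set Y), IsSetValued θ → IsLSC θ → (∀ x, IsClosed (θ x)) →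
    ∃ g : X → Set Y, IsSelection g θ ∧ compactnessDegree (closure (image g)) ≤ τ

def K4 : Prop :=
  ∀ (Y : Type u) [TopologicalSpace Y] [TopologicalSpace.IsCompletelyMetrizableSpace Y]
    (θ : X → Set Y), IsSetValued θ → IsLSC θ → (∀ x, IsClosed (θ x)) →
    ∃ g : X → Y, (∀ x, g x ∈ θ x) ∧ compactnessDegree (closure (range g)) ≤ τ

def K5 : Prop :=
  ∀ (Y : Type u) [TopologicalSpace Y] [DiscreteTopology Y]
    (θ : X → Set Y), IsSetValued θ → IsLSC θ →
    ∃ φ : X → Set Y, IsSelection φ θ ∧ IsLSC φ ∧ #(image φ) < τ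

def K6 : Prop :=
  ∀ (Y : Type u) [TopologicalSpace Y] [DiscreteTopology Y]
    (θ : X → Set Y), IsSetValued θ → IsLSC θ →
    ∃ g : X → Set Y, IsSelection g θ ∧ #(image g) < τ

def K7 : Prop :=
  ∀ (Y : Type u) [TopologicalSpace Y] [DiscreteTopology Y]
    (θ : X → Set Y), IsSetValued θ → IsLSC θ →
    ∃ g : X → Y, (∀ x, g x ∈ θ x) ∧ #(range g) < τ

def K8 : Prop :=
  ∀ γ : Set (Set X), (∀ U ∈ γ, IsOpen U) → ⋃₀ γ = univ →
    ∃ ξ : Set (Set X), ξ ⊆ γ ∧ ⋃₀ ξ = univ ∧ #ξ < τ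

def K11 : Prop :=
  ∀ (Y : Type u) [TopologicalSpace Y] [TopologicalSpace.IsCompletelyMetrizableSpace Y]
    (θ : X → Set Y), IsSetValued θ → IsLSC θ → (∀ x, IsClosed (θ x)) →
    ∃ φ : X → Set Y, IsSelection φ θ ∧ IsLSC φ ∧ weight (image φ) < τ

end Properties

end Selections

open Topology

/-! The hypotheses already force K1: fewer than `τ` members of an open cover of `X` cover `F`, and
what they miss is closed and off `F`. Hence every assertion is proved outright, and the equivalences
follow. The substance lies in K2 and K11.

The selection consists of the limits of branches of a tree. A node carries open sets `U` and `T`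
such that `θ` meets `T` over `closure U`; the children cover `U`, and their sets `T` shrink in
diameter. Completeness and closed values put the limits inside `θ`, and openness of the sets `U`
gives lower semi-continuity.

The difficulty is size: for singular `τ`, fewer than `τ` nodes with fewer than `τ` children each may
have `τ` children in all. The remedy is a core `K` (`exists_isCore`) whose open covers have
subcovers of size below `cof τ`, while each closed set off `K` has degree below `τ`. For regular `τ`
the whole space serves; for singular `τ` the points without a neighbourhood of small degree do
(`isCore_bigPoints`). A node near the core has fewer than `cof τ` children of its own kind. The
others lie in a closed set `Z` off `K` that all their descendants inherit, so branching there is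
bounded once and for all (`card_level`, `card_descendants_le`).

If `cof τ` is uncountable, the whole tree has fewer than `τ` nodes, so the image has a dense set of
size below `τ` in its closure. If `cof τ = ℵ₀`, each level has finitely many core nodes and the
remaining branches have limits in the closure of a small set; the image is totally bounded up to
small pieces, and an ultrafilter argument concludes (`smallSubcovers_of_totallyBounded`). -/

namespace Selections

/-- Every family of open subsets of the ambient space that covers `S` has a subfamily of
cardinality `< m` that still covers `S`. -/
def SmallSubcovers {X : Type u} [TopologicalSpace X] (S : Set X) (m : Cardinal.{u}) : Prop :=
  ∀ γ : Set (Set X), (∀ U ∈ γ, IsOpen U) → S ⊆ ⋃₀ γ → ∃ ξ ⊆ γ, S ⊆ ⋃₀ ξ ∧ #ξ < m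

/-! ### Small subcovers and relative paracompactness -/

section Covers

variable {X : Type u} [TopologicalSpace X] {S E K G : Set X} {m m' τ : Cardinal.{u}}

theorem SmallSubcovers.mono (h : SmallSubcovers S m) (hm : m ≤ m') : SmallSubcovers S m' :=
  fun γ h1 h2 => by
    obtain ⟨ξ, a, b, c⟩ := h γ h1 h2
    exact ⟨ξ, a, b, c.trans_le hm⟩

theorem SmallSubcovers.of_isClosed_subset (h : SmallSubcovers S m) (hE : IsClosed E)
    (hES : E ⊆ S) : SmallSubcovers E m := by
  intro γ h1 h2
  obtain ⟨ξ, a, b, c⟩ := h (insert Eᶜ γ) (by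
      rintro U (rfl | hU)
      exacts [hE.isOpen_compl, h1 U hU]) (by
      intro x hx
      by_cases hxE : x ∈ E
      · obtain ⟨U, hU, hxU⟩ := h2 hxE
        exact ⟨U, Or.inr hU, hxU⟩
      · exact ⟨Eᶜ, Or.inl rfl, hxE⟩)
  refine ⟨ξ ∩ γ, inter_subset_right, fun x hx => ?_,
    (Cardinal.mk_le_mk_of_subset inter_subset_left).trans_lt c⟩
  obtain ⟨U, hU, hxU⟩ := b (hES hx)
  rcases a hU with rfl | hU'
  · exact absurd hx hxU
  · exact ⟨U, ⟨hU, hU'⟩, hxU⟩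

/-- A neighbourhood assignment has a subcover indexed by few points. -/
theorem SmallSubcovers.exists_points (h : SmallSubcovers S m) (N : X → Set X)
    (hN : ∀ x ∈ S, IsOpen (N x) ∧ x ∈ N x) :
    ∃ P ⊆ S, #P < m ∧ S ⊆ ⋃ x ∈ P, N x := by
  obtain ⟨ξ, a, b, c⟩ := h (N '' S) (by rintro _ ⟨x, hx, rfl⟩; exact (hN x hx).1)
    (fun x hx => ⟨N x, ⟨x, hx, rfl⟩, (hN x hx).2⟩)
  choose f hfS hf using a
  refine ⟨range fun V : ξ => f V.2, ?_, Cardinal.mk_range_le.trans_lt c, fun x hx => ?_⟩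
  · rintro _ ⟨V, rfl⟩
    exact hfS V.2
  · obtain ⟨V, hV, hxV⟩ := b hx
    simp only [mem_iUnion]
    exact ⟨f hV, ⟨⟨V, hV⟩, rfl⟩, by rw [hf hV]; exact hxV⟩

theorem smallSubcovers_of_refinements
    (h : ∀ γ : Set (Set X), (∀ U ∈ γ, IsOpen U) → S ⊆ ⋃₀ γ →
      ∃ ξ : Set (Set X), (∀ V ∈ ξ, ∃ U ∈ γ, V ⊆ U) ∧ S ⊆ ⋃₀ ξ ∧ #ξ < m) :
    SmallSubcovers S m := by
  intro γ h1 h2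
  obtain ⟨ξ, a, b, c⟩ := h γ h1 h2
  choose f hf hVf using a
  refine ⟨range fun V : ξ => f V V.2, ?_, fun x hx => ?_, Cardinal.mk_range_le.trans_lt c⟩
  · rintro _ ⟨V, rfl⟩
    exact hf _ _
  · obtain ⟨V, hV, hxV⟩ := b hx
    exact ⟨f V hV, ⟨⟨V, hV⟩, rfl⟩, hVf V hV hxV⟩

theorem smallSubcovers_iff_compactnessDegree_le :
    SmallSubcovers S m ↔ compactnessDegree S ≤ m := by
  rw [compactnessDegree_le_iff]
  constructor
  · intro h γ h1 h2
    obtain ⟨ξ, a, b, c⟩ := h {U | IsOpen U ∧ ((↑) ⁻¹' U : Set S) ∈ γ} (fun U hU => hU.1) (by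
      intro x hx
      obtain ⟨V, hV, hxV⟩ : (⟨x, hx⟩ : S) ∈ ⋃₀ γ := h2 ▸ mem_univ _
      obtain ⟨U, hU, rfl⟩ := isOpen_induced_iff.1 (h1 V hV)
      exact ⟨U, ⟨hU, hV⟩, hxV⟩)
    refine ⟨(fun U => ((↑) ⁻¹' U : Set S)) '' ξ, ?_, ?_, ?_, Cardinal.mk_image_le.trans_lt c⟩
    · rintro _ ⟨U, hU, rfl⟩
      exact (a hU).1.preimage continuous_subtype_val
    · refine eq_univ_of_forall fun x => ?_
      obtain ⟨U, hU, hxU⟩ := b x.2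
      exact ⟨_, ⟨U, hU, rfl⟩, hxU⟩
    · rintro _ ⟨U, hU, rfl⟩
      exact ⟨_, (a hU).2, Subset.rfl⟩
  · intro h
    refine smallSubcovers_of_refinements fun γ h1 h2 => ?_
    obtain ⟨ξ, -, b, c, d⟩ := h ((fun U => ((↑) ⁻¹' U : Set S)) '' γ)
      (by rintro _ ⟨U, hU, rfl⟩; exact (h1 U hU).preimage continuous_subtype_val)
      (eq_univ_of_forall fun x => by
        obtain ⟨U, hU, hxU⟩ := h2 x.2
        exact ⟨_, ⟨U, hU, rfl⟩, hxU⟩)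
    refine ⟨(fun V : Set S => ((↑) '' V : Set X)) '' ξ, ?_, fun x hx => ?_,
      Cardinal.mk_image_le.trans_lt d⟩
    · rintro _ ⟨V, hV, rfl⟩
      obtain ⟨_, ⟨U, hU, rfl⟩, hVU⟩ := c V hV
      exact ⟨U, hU, image_subset_iff.2 hVU⟩
    · obtain ⟨V, hV, hxV⟩ : (⟨x, hx⟩ : S) ∈ ⋃₀ ξ := b ▸ mem_univ _
      exact ⟨_, ⟨V, hV, rfl⟩, ⟨_, hxV, rfl⟩⟩

theorem smallSubcovers_of_compactnessDegree_lt (h : compactnessDegree S < τ) :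
    ∃ l < τ, SmallSubcovers S l :=
  ⟨_, h, smallSubcovers_iff_compactnessDegree_le.2 le_rfl⟩

theorem SmallSubcovers.exists_least (h : SmallSubcovers S m) :
    ∃ l ≤ m, SmallSubcovers S l ∧ ∀ k, SmallSubcovers S k → l ≤ k :=
  ⟨sInf {k | SmallSubcovers S k}, csInf_le' h, csInf_mem (s := {k | SmallSubcovers S k}) ⟨m, h⟩,
    fun _ hk => csInf_le' hk⟩

theorem SmallSubcovers.iUnion {I : Type u} {C : I → Set X} {l : Cardinal.{u}}
    (h : ∀ i, SmallSubcovers (C i) l) (hI : #I * l < τ) : SmallSubcovers (⋃ i, C i) τ := by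
  intro γ h1 h2
  choose ξ a b c using fun i => h i γ h1 ((subset_iUnion C i).trans h2)
  refine ⟨⋃ i, ξ i, iUnion_subset a, iUnion_subset fun i => (b i).trans
    (sUnion_subset_sUnion (subset_iUnion ξ i)), ?_⟩
  refine (Cardinal.mk_iUnion_le_sum_mk.trans ?_).trans_lt hI
  refine (Cardinal.sum_le_sum _ (fun _ => l) fun i => (c i).le).trans ?_
  simp

theorem SmallSubcovers.union (hτ : ℵ₀ ≤ τ) (h : SmallSubcovers S τ)
    (h' : SmallSubcovers E τ) : SmallSubcovers (S ∪ E) τ := by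
  intro γ h1 h2
  obtain ⟨ξ, a, b, c⟩ := h γ h1 (subset_union_left.trans h2)
  obtain ⟨ξ', a', b', c'⟩ := h' γ h1 (subset_union_right.trans h2)
  refine ⟨ξ ∪ ξ', union_subset a a', union_subset
    (b.trans (sUnion_subset_sUnion subset_union_left))
    (b'.trans (sUnion_subset_sUnion subset_union_right)),
    (Cardinal.mk_union_le _ _).trans_lt (Cardinal.add_lt_of_lt hτ c c')⟩

/-- If `K` and all closed sets off `K` have few-element subcovers, then so does the space. -/
theorem SmallSubcovers.of_off (hτ : ℵ₀ ≤ τ) (hS : IsClosed S) (hK : SmallSubcovers K τ)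
    (h : ∀ Z ⊆ S, IsClosed Z → Disjoint Z K → ∃ l < τ, SmallSubcovers Z l) (hKS : K ⊆ S) :
    SmallSubcovers S τ := by
  intro γ h1 h2
  obtain ⟨ξ, a, b, c⟩ := hK γ h1 (hKS.trans h2)
  -- The part missed by the subcover of `K` is closed and disjoint from `K`.
  obtain ⟨l, hl, hZ⟩ := h (S \ ⋃₀ ξ) sdiff_subset
    (hS.sdiff (isOpen_sUnion fun U hU => h1 U (a hU)))
    (disjoint_left.2 fun x hx hxK => hx.2 (b hxK))
  obtain ⟨ξ', a', b', c'⟩ := hZ γ h1 (sdiff_subset.trans h2)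
  refine ⟨ξ ∪ ξ', union_subset a a', fun x hx => ?_,
    (Cardinal.mk_union_le _ _).trans_lt (Cardinal.add_lt_of_lt hτ c (c'.trans hl))⟩
  by_cases hxξ : x ∈ ⋃₀ ξ
  · exact sUnion_subset_sUnion subset_union_left hxξ
  · exact sUnion_subset_sUnion subset_union_right (b' ⟨hx, hxξ⟩)

theorem exists_open_closure_subset [RegularSpace X] {x : X} (hG : IsOpen G) (hx : x ∈ G) :
    ∃ N, IsOpen N ∧ x ∈ N ∧ closure N ⊆ G := by
  obtain ⟨V, hV, hVc, hVG⟩ := exists_mem_nhds_isClosed_subset (hG.mem_nhds hx)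
  exact ⟨interior V, isOpen_interior, mem_interior_iff_mem_nhds.2 hV,
    (hVc.closure_subset_iff.2 interior_subset).trans hVG⟩

theorem ParacompactIn.of_isClosed_subset (h : ParacompactIn S) (hK : IsClosed K) (hKS : K ⊆ S) :
    ParacompactIn K := by
  intro M W hW hKW
  -- The extra index `none` carries `Kᶜ`, which completes the cover of `S` and can be dropped
  -- afterwards because it misses `K`.
  obtain ⟨W', a, b, c, d⟩ := h (Option M) (fun o => o.elim Kᶜ W)
    (by rintro (_ | μ); exacts [hK.isOpen_compl, hW μ])
    (fun x _ => by
      by_cases hxK : x ∈ K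
      · obtain ⟨μ, hμ⟩ := mem_iUnion.1 (hKW hxK)
        exact mem_iUnion.2 ⟨some μ, hμ⟩
      · exact mem_iUnion.2 ⟨none, hxK⟩)
  refine ⟨fun μ => W' (some μ), fun μ => a _, b.comp_injective (Option.some_injective M),
    fun x hx => ?_, fun μ => d _⟩
  obtain ⟨_ | μ, hμ⟩ := mem_iUnion.1 (c (hKS hx))
  · exact absurd hx (d none hμ)
  · exact mem_iUnion.2 ⟨μ, hμ⟩

/-- For a locally finite family the closure of the union is the union of the closures, so it
suffices to shrink the cover of `K` by open sets whose closures lie in `G`. -/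
theorem ParacompactIn.exists_open_between [RegularSpace X] (h : ParacompactIn K)
    (hG : IsOpen G) (hKG : K ⊆ G) : ∃ O, IsOpen O ∧ K ⊆ O ∧ closure O ⊆ G := by
  obtain ⟨W', a, b, c, d⟩ := h {N : Set X // IsOpen N ∧ closure N ⊆ G} (fun N => N)
    (fun N => N.2.1) (fun x hx => by
      obtain ⟨N, hN, hxN, hNG⟩ := exists_open_closure_subset hG (hKG hx)
      exact mem_iUnion.2 ⟨⟨N, hN, hNG⟩, hxN⟩)
  refine ⟨⋃ N, W' N, isOpen_iUnion a, c, ?_⟩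
  rw [b.closure_iUnion]
  exact iUnion_subset fun N => (closure_mono (d N)).trans N.2.2

theorem ParacompactIn.isClosed [T3Space X] (h : ParacompactIn K) : IsClosed K := by
  refine isClosed_of_closure_subset fun x hx => by_contra fun hxK => ?_
  obtain ⟨O, -, hKO, hO⟩ := h.exists_open_between (isOpen_compl_singleton (x := x))
    (fun y hy hyx => hxK (hyx ▸ hy))
  exact hO (closure_mono hKO hx) rfl

end Covers

/-! ### Cofinal and bounded families of cardinals -/

section Cardinals

variable {τ : Cardinal.{u}}

/-- Cofinal families of cardinals indexed by the cofinality. -/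
theorem exists_cofinal_cardinals (τ : Cardinal.{u}) :
    ∃ (I : Type u) (c : I → Cardinal.{u}), #I = τ.ord.cof ∧ (∀ i, c i < τ) ∧
      ∀ l < τ, ∃ i, l ≤ c i := by
  obtain ⟨s, hs, hcard⟩ := Order.exists_cof_eq τ.ord.ToType
  rw [Ordinal.cof_toType] at hcard
  -- The witnesses are the cardinalities of the initial segments at the points of a cofinal set of
  -- minimal size.
  refine ⟨s, fun a => (Ordinal.typein (α := τ.ord.ToType) (· < ·) a).card, hcard, fun a => ?_,
    fun l hl => ?_⟩
  · have := Ordinal.typein_lt_type (α := τ.ord.ToType) (· < ·) a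
    rw [Ordinal.type_toType] at this
    exact Cardinal.lt_ord.1 this
  · have hl' : l.ord < Ordinal.type (α := τ.ord.ToType) (· < ·) := by
      rw [Ordinal.type_toType]
      exact Cardinal.ord_lt_ord.2 hl
    obtain ⟨b, hb⟩ := Ordinal.typein_surj (α := τ.ord.ToType) (· < ·) hl'
    obtain ⟨a, ha, hba⟩ := hs b
    refine ⟨⟨a, ha⟩, ?_⟩
    have : l.ord ≤ Ordinal.typein (α := τ.ord.ToType) (· < ·) a := by
      rw [← hb]
      exact (Ordinal.typein_le_typein (· < ·)).2 (not_lt.2 hba)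
    simpa using Ordinal.card_le_card this

theorem isRegular_cof_ord (hτ : ℵ₀ ≤ τ) : τ.ord.cof.IsRegular :=
  Cardinal.isRegular_cof (Cardinal.isSuccLimit_ord hτ)

/-- A family of cardinals below a limit cardinal is bounded if all families strictly below it
are. -/
theorem exists_bound_of_forall_lt {I : Type u} (κ : I → Cardinal.{u}) (h0 : ∀ i, 0 < κ i)
    (hκ : ∀ i, κ i < τ)
    (H : ∀ ν : I → Cardinal.{u}, (∀ i, ν i < κ i) → ∃ l < τ, ∀ i, ν i ≤ l) :
    ∃ l < τ, ∀ i, κ i ≤ l := by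
  classical
  by_contra! hcon
  -- The test family sends `i` to the supremum of the values of `κ` below `κ i`, or to 0 if that
  -- supremum is `κ i` itself. For consecutive values `κ i < κ j` above `l`, its value at `j` is `κ
  -- i`, which exceeds the bound `l`.
  obtain ⟨l, hl, hle⟩ := H
    (fun i => if sSup (range κ ∩ Iio (κ i)) < κ i then sSup (range κ ∩ Iio (κ i)) else 0)
    (fun i => by split_ifs with h; exacts [h, h0 i])
  obtain ⟨_, ⟨i, hi, rfl⟩, hmin⟩ := WellFounded.has_min (wellFounded_lt (α := Cardinal.{u}))
    {c | ∃ i, l < κ i ∧ κ i = c} (by obtain ⟨i, hi⟩ := hcon l hl; exact ⟨_, i, hi, rfl⟩)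
  obtain ⟨_, ⟨j, hj, rfl⟩, hmin'⟩ := WellFounded.has_min (wellFounded_lt (α := Cardinal.{u}))
    {c | ∃ j, κ i < κ j ∧ κ j = c}
    (by obtain ⟨j, hj⟩ := hcon (κ i) (hκ i); exact ⟨_, j, hj, rfl⟩)
  have hs : sSup (range κ ∩ Iio (κ j)) = κ i := by
    refine IsGreatest.csSup_eq ⟨⟨⟨i, rfl⟩, hj⟩, ?_⟩
    rintro _ ⟨⟨k, rfl⟩, hk⟩
    exact not_lt.1 fun hik => hmin' _ ⟨k, hik, rfl⟩ hk
  have := hle j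
  rw [hs, if_pos hj] at this
  exact absurd hi (not_lt.2 this)

end Cardinals

/-! ### Existence of a core -/

section Core

variable {X : Type u} [TopologicalSpace X] {F : Set X} {τ : Cardinal.{u}}

/-- For a locally finite family of closed sets the degrees of compactness are uniformly bounded
away from that of the space. -/
theorem SmallSubcovers.exists_bound (h : SmallSubcovers (univ : Set X) τ) {I : Type u}
    {C : I → Set X} (hC : ∀ i, IsClosed (C i)) (hlf : LocallyFinite C) (ν : I → Cardinal.{u})
    (hν : ∀ i, ¬ SmallSubcovers (C i) (ν i)) : ∃ l < τ, ∀ i, ν i ≤ l := by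
  simp only [SmallSubcovers, not_forall, not_exists, not_and, not_lt] at hν
  choose γ hγ hcov hbad using hν
  choose! G hGγ hG using fun (i : I) (x : X) (hx : x ∈ C i) => hcov i hx
  -- The neighbourhood of `x` avoids every `C i` not containing `x` and lies in one member of the
  -- bad cover of each of the finitely many others. One set `P` of points then yields a subcover of
  -- size at most `#P` for all `i` at once.
  obtain ⟨P, -, hP, hPcov⟩ := h.exists_points
    (fun x => interior ((⋂ (i) (_ : x ∉ C i), (C i)ᶜ) ∩ ⋂ i ∈ {i | x ∈ C i}, G i x))
    (fun x _ => ⟨isOpen_interior, mem_interior_iff_mem_nhds.2 (Filter.inter_mem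
      (hlf.iInter_compl_mem_nhds hC x)
      ((Filter.biInter_mem (hlf.point_finite x)).2 fun i hi =>
        (hγ i _ (hGγ i x hi)).mem_nhds (hG i x hi)))⟩)
  refine ⟨#P, hP, fun i => (hbad i ((fun x => G i x) '' (P ∩ C i)) ?_ ?_).trans
    (Cardinal.mk_image_le.trans (Cardinal.mk_le_mk_of_subset inter_subset_left))⟩
  · rintro _ ⟨x, hx, rfl⟩
    exact hGγ i x hx.2
  · intro z hz
    obtain ⟨x, hxP, hzx⟩ := mem_iUnion₂.1 (hPcov (mem_univ z))
    obtain ⟨h1, h2⟩ := interior_subset hzx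
    have hx : x ∈ C i := by
      by_contra hx
      exact mem_iInter₂.1 h1 i hx hz
    exact ⟨_, ⟨x, ⟨hxP, hx⟩, rfl⟩, mem_iInter₂.1 h2 i hx⟩

/-- A closed set outside of which the space is compact to a degree below `τ`, and which itself
has small subcovers relative to the cofinality of `τ`. -/
structure IsCore (K : Set X) (τ : Cardinal.{u}) : Prop where
  isClosed : IsClosed K
  smallSubcovers : SmallSubcovers K τ.ord.cof
  exists_open_between : ∀ G, IsOpen G → K ⊆ G → ∃ O, IsOpen O ∧ K ⊆ O ∧ closure O ⊆ G
  off : ∀ Z, IsClosed Z → Disjoint Z K → ∃ l < τ, SmallSubcovers Z l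

theorem not_smallSubcovers_zero (S : Set X) : ¬ SmallSubcovers S 0 := fun h => by
  obtain ⟨_, _, _, hlt⟩ := h {univ} (by simp) (by simp)
  exact absurd hlt not_lt_zero

theorem isCore_univ (hτ : τ.IsRegular) (h : SmallSubcovers (univ : Set X) τ) :
    IsCore (univ : Set X) τ where
  isClosed := isClosed_univ
  smallSubcovers := by rwa [hτ.cof_ord]
  exists_open_between G _ hG := ⟨univ, isOpen_univ, Subset.rfl, by simpa using hG⟩
  off Z _ hZ := ⟨1, Cardinal.one_lt_aleph0.trans_le hτ.aleph0_le, fun γ _ _ =>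
    ⟨∅, empty_subset _, by rw [disjoint_univ.1 hZ]; exact empty_subset _, by simp⟩⟩

/-- The points all of whose neighbourhoods have degree of compactness at least `τ`. -/
def bigPoints (X : Type u) [TopologicalSpace X] (τ : Cardinal.{u}) : Set X :=
  {x | ∀ N, IsOpen N → x ∈ N → ∀ l < τ, ¬ SmallSubcovers (closure N) l}

theorem isClosed_bigPoints : IsClosed (bigPoints X τ) := by
  refine ⟨isOpen_iff_mem_nhds.2 fun x hx => ?_⟩
  simp only [bigPoints, mem_compl_iff, mem_ofPred_eq, not_forall, not_not] at hx
  obtain ⟨N, hN, hxN, l, hl, hs⟩ := hx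
  exact Filter.mem_of_superset (hN.mem_nhds hxN) fun y hy hyK => hyK N hN hy l hl hs

/-- Both size conditions come from `SmallSubcovers.exists_bound`. If a locally finite shrinking had
`cof τ` members meeting the core, they would contain closed neighbourhoods whose degrees are
unbounded in `τ`. Off the core, `F` is covered locally finitely by fewer than `τ` sets whose
closures have degrees below `τ`; these degrees are bounded, so the union has degree below the limit
cardinal `τ`. -/
theorem isCore_bigPoints [T3Space X] (hτ : τ.IsSingular) (h : SmallSubcovers (univ : Set X) τ)
    (hF : ParacompactIn F) (hoff : ∀ Z, IsClosed Z → Disjoint Z F → ∃ l < τ, SmallSubcovers Z l) :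
    IsCore (bigPoints X τ) τ := by
  classical
  have hFc := hF.isClosed
  have hK : IsClosed (bigPoints X τ) := isClosed_bigPoints
  have hKF : bigPoints X τ ⊆ F := fun x hx => by
    by_contra hxF
    obtain ⟨N, hN, hxN, hNF⟩ := exists_open_closure_subset hFc.isOpen_compl hxF
    obtain ⟨l, hl, hs⟩ := hoff _ isClosed_closure (disjoint_compl_left.mono_left hNF)
    exact hx N hN hxN l hl hs
  have hKp : ParacompactIn (bigPoints X τ) := hF.of_isClosed_subset hK hKF
  have hsucc : ∀ l < τ, Order.succ l < τ := fun l hl => hτ.isSuccLimit.succ_lt hl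
  refine ⟨hK, ?_, fun G => hKp.exists_open_between, fun Y hY hYK => ?_⟩
  · intro γ h1 h2
    obtain ⟨W, hW, hlf, hcov, hsub⟩ := hKp γ (fun U => U) (fun U => h1 U U.2)
      (by rwa [← sUnion_eq_iUnion])
    refine ⟨(↑) '' {U : γ | (W U ∩ bigPoints X τ).Nonempty}, ?_, fun x hx => ?_, ?_⟩
    · rintro _ ⟨U, -, rfl⟩
      exact U.2
    · obtain ⟨U, hU⟩ := mem_iUnion.1 (hcov hx)
      exact ⟨U, ⟨U, ⟨x, hU, hx⟩, rfl⟩, hsub U hU⟩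
    · refine Cardinal.mk_image_le.trans_lt (not_le.1 fun hle => ?_)
      -- The members meeting the core are matched with a cofinal family `c`; a neighbourhood of a
      -- core point inside the `i`-th one has no subcovers of size below `c i`.
      obtain ⟨I, c, hI, hc, hcof⟩ := exists_cofinal_cardinals τ
      rw [← hI] at hle
      obtain ⟨e⟩ := hle
      choose x hxW hxK using fun i => (e i).2
      choose N hN hxN hNW using fun i => exists_open_closure_subset (hW (e i)) (hxW i)
      obtain ⟨l, hl, hb⟩ := h.exists_bound (C := fun i => closure (N i))
        (fun i => isClosed_closure)
        ((hlf.comp_injective (Subtype.val_injective.comp e.injective)).subset hNW) c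
        (fun i => hxK i _ (hN i) (hxN i) _ (hc i))
      obtain ⟨i, hi⟩ := hcof _ (hsucc l hl)
      exact absurd (hi.trans (hb i)) (not_le.2 (Order.lt_succ l))
  · have hloc : ∀ x ∈ Y, ∃ N, IsOpen N ∧ x ∈ N ∧ ∃ l < τ, SmallSubcovers (closure N) l := by
      intro x hx
      have := disjoint_left.1 hYK hx
      simpa only [bigPoints, mem_ofPred_eq, not_forall, not_not, exists_prop] using this
    choose! N hN hxN l hl hNl using hloc
    obtain ⟨P, hPY, hP, hPcov⟩ := (h.of_isClosed_subset (hY.inter hFc)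
      (subset_univ _)).exists_points N (fun x hx => ⟨hN x hx.1, hxN x hx.1⟩)
    obtain ⟨W, hW, hlf, hcov, hsub⟩ := (hF.of_isClosed_subset (hY.inter hFc) inter_subset_right) P
      (fun x => N x) (fun x => hN x (hPY x.2).1) (by rwa [biUnion_eq_iUnion] at hPcov)
    have hWs : ∀ x : P, SmallSubcovers (closure (W x)) (l x) := fun x =>
      (hNl x (hPY x.2).1).of_isClosed_subset isClosed_closure (closure_mono (hsub x))
    choose κ hκl hκ hκmin using fun x : P => (hWs x).exists_least
    -- `exists_bound` needs cardinals at which small subcovers fail, hence it applies only strictly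
    -- below the least degrees `κ`.
    obtain ⟨b, hb, hκb⟩ := exists_bound_of_forall_lt κ
      (fun x => pos_iff_ne_zero.2 fun h0 => not_smallSubcovers_zero _ (h0 ▸ hκ x))
      (fun x => (hκl x).trans_lt (hl x (hPY x.2).1))
      (fun ν hν => h.exists_bound (fun x => isClosed_closure) hlf.closure ν
        (fun x hs => absurd (hκmin x _ hs) (not_le.2 (hν x))))
    obtain ⟨b', hb', hY'⟩ := hoff (Y \ ⋃ x, W x) (hY.sdiff (isOpen_iUnion hW))
      (disjoint_left.2 fun x hx hxF => hx.2 (hcov ⟨hx.1, hxF⟩))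
    have hω : ℵ₀ < τ := lt_of_le_of_ne hτ.aleph0_le fun h0 => Cardinal.not_isSingular_aleph0 (h0 ▸ hτ)
    have hm : Order.succ (#P * b) < τ := hsucc _ (Cardinal.mul_lt_of_lt hτ.aleph0_le hP hb)
    have hU : SmallSubcovers (⋃ x, closure (W x)) (Order.succ (#P * b)) :=
      SmallSubcovers.iUnion (fun x => (hκ x).mono (hκb x)) (Order.lt_succ _)
    refine ⟨max (max (Order.succ (#P * b)) b') ℵ₀, max_lt (max_lt hm hb') hω, ?_⟩
    refine SmallSubcovers.of_isClosed_subset (SmallSubcovers.union (le_max_right _ _)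
      (hU.mono ((le_max_left _ _).trans (le_max_left _ _)))
      (hY'.mono ((le_max_right _ _).trans (le_max_left _ _)))) hY fun x hx => ?_
    by_cases hxW : x ∈ ⋃ x, W x
    · exact Or.inl (iUnion_mono (fun _ => subset_closure) hxW)
    · exact Or.inr ⟨hx, hxW⟩

theorem exists_isCore [T3Space X] (hτ : ℵ₀ ≤ τ) (h : SmallSubcovers (univ : Set X) τ)
    (hF : ParacompactIn F) (hoff : ∀ Z, IsClosed Z → Disjoint Z F → ∃ l < τ, SmallSubcovers Z l) :
    ∃ K : Set X, IsCore K τ := by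
  rcases Cardinal.isRegular_or_isSingular hτ with hr | hs
  · exact ⟨univ, isCore_univ hr h⟩
  · exact ⟨_, isCore_bigPoints hs h hF hoff⟩

end Core

/-! ### Trees of approximations and their branch limits -/

section Tree

/-- A node of a tree of approximations: an open set of the domain, an open set of the range, and
possibly a closed set of the domain off the core in which the first one lies. -/
structure Node (X Y : Type u) where
  U : Set X
  T : Set Y
  Z : Option (Set X)

variable {X Y : Type u} [TopologicalSpace X] [MetricSpace Y] {K : Set X} {τ : Cardinal.{u}}
  {θ : X → Set Y}

/-- The conditions on a single node. -/
structure Node.IsValid (K : Set X) (θ : X → Set Y) (a : Node X Y) : Prop where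
  isOpen_U : IsOpen a.U
  isOpen_T : IsOpen a.T
  nonempty : ∀ x ∈ closure a.U, (θ x ∩ a.T).Nonempty
  off : ∀ Z, a.Z = some Z → IsClosed Z ∧ Disjoint Z K ∧ a.U ⊆ Z

/-- The conditions on the set `C` of immediate successors of a node. -/
structure Node.IsChildren (K : Set X) (τ : Cardinal.{u}) (θ : X → Set Y) (ε : ℝ) (a : Node X Y)
    (C : Set (Node X Y)) : Prop where
  isValid : ∀ c ∈ C, c.IsValid K θ
  subset_U : ∀ c ∈ C, c.U ⊆ a.U
  subset_T : ∀ c ∈ C, closure c.T ⊆ a.T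
  dist_le : ∀ c ∈ C, ∀ y ∈ closure c.T, ∀ y' ∈ closure c.T, dist y y' ≤ ε
  cover : a.U ⊆ ⋃ c ∈ C, c.U
  core : a.Z = none → #{c ∈ C | c.Z = none} < τ.ord.cof ∧ #C < τ ∧
    ∃ Z, IsClosed Z ∧ Disjoint Z K ∧ ∀ c ∈ C, c.Z = none ∨ c.Z = some Z
  off : ∀ Z, a.Z = some Z → (∀ c ∈ C, c.Z = some Z) ∧ ∀ l, SmallSubcovers Z l → #C < l

/-- Over each `x ∈ E` a small ball about a point of `θ x ∩ T` is met by `θ` on a whole neighbourhood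
of `x`, which regularity shrinks to one with the same property on its closure. Few such
neighbourhoods cover `E`; `V` is their union. -/
theorem exists_nodes [RegularSpace X] (hθ : IsLSC θ) {U E G : Set X} {T : Set Y}
    (hU : IsOpen U) (hT : IsOpen T) (hUT : ∀ x ∈ closure U, (θ x ∩ T).Nonempty)
    (hE : E ⊆ closure U) (hG : IsOpen G) (hEG : E ⊆ G) {m : Cardinal.{u}}
    (hm : SmallSubcovers E m) (z : Option (Set X)) {ε : ℝ} (hε : 0 < ε) :
    ∃ C : Set (Node X Y), #C < m ∧
      (∀ c ∈ C, IsOpen c.U ∧ IsOpen c.T ∧ (∀ x ∈ closure c.U, (θ x ∩ c.T).Nonempty) ∧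
        c.U ⊆ U ∩ G ∧ closure c.T ⊆ T ∧
        (∀ y ∈ closure c.T, ∀ y' ∈ closure c.T, dist y y' ≤ ε) ∧ c.Z = z) ∧
      ∃ V, IsOpen V ∧ E ⊆ V ∧ U ∩ V ⊆ ⋃ c ∈ C, c.U := by
  have key : ∀ x ∈ E, ∃ N : Set X, ∃ B : Set Y, IsOpen N ∧ x ∈ N ∧ N ⊆ G ∧ IsOpen B ∧
      (∀ x ∈ closure N, (θ x ∩ B).Nonempty) ∧ closure B ⊆ T ∧
      (∀ y ∈ closure B, ∀ y' ∈ closure B, dist y y' ≤ ε) := by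
    intro x hx
    obtain ⟨r, hrθ, hrT⟩ := hUT x (hE hx)
    obtain ⟨δ, hδ, hδT⟩ := Metric.nhds_basis_closedBall.mem_iff.1 (hT.mem_nhds hrT)
    -- `δ` keeps the closed ball inside `T`, and `ε / 2` bounds its diameter by `ε`.
    set ρ := min δ (ε / 2)
    have hρ : 0 < ρ := lt_min hδ (half_pos hε)
    obtain ⟨N, hN, hxN, hNc⟩ := exists_open_closure_subset
      ((hθ (Metric.ball r ρ) Metric.isOpen_ball).inter hG)
      ⟨⟨r, hrθ, Metric.mem_ball_self hρ⟩, hEG hx⟩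
    refine ⟨N, Metric.ball r ρ, hN, hxN, fun y hy => (hNc (subset_closure hy)).2,
      Metric.isOpen_ball, fun y hy => (hNc hy).1, Metric.closure_ball_subset_closedBall.trans
      ((Metric.closedBall_subset_closedBall (min_le_left _ _)).trans hδT), fun y hy y' hy' => ?_⟩
    have h1 := Metric.mem_closedBall.1 (Metric.closure_ball_subset_closedBall hy)
    have h2 := Metric.mem_closedBall'.1 (Metric.closure_ball_subset_closedBall hy')
    have h3 := dist_triangle y r y'
    have h4 : ρ ≤ ε / 2 := min_le_right _ _
    linarith
  choose! N B hN hxN hNG hB hNB hBT hBε using key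
  obtain ⟨P, hPE, hP, hPcov⟩ := hm.exists_points N (fun x hx => ⟨hN x hx, hxN x hx⟩)
  refine ⟨(fun x => ⟨U ∩ N x, B x, z⟩) '' P, Cardinal.mk_image_le.trans_lt hP, ?_,
    ⋃ x ∈ P, N x, isOpen_biUnion fun x hx => hN x (hPE hx), hPcov, ?_⟩
  · rintro _ ⟨x, hx, rfl⟩
    have hxE := hPE hx
    exact ⟨hU.inter (hN x hxE), hB x hxE,
      fun y hy => hNB x hxE y (closure_mono inter_subset_right hy),
      inter_subset_inter_right _ (hNG x hxE), hBT x hxE, hBε x hxE, rfl⟩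
  · rintro y ⟨hyU, hyV⟩
    obtain ⟨x, hx, hyx⟩ := mem_iUnion₂.1 hyV
    exact mem_biUnion (mem_image_of_mem _ hx) ⟨hyU, hyx⟩

/-- A core node splits in two: fewer than `cof τ` children cover a neighbourhood `V` of the core
part of `closure a.U`, and the rest is covered by children lying in a single closed set off the
core. An off node passes its own `Z` to all its children. -/
theorem Node.IsValid.exists_children [RegularSpace X] (hτ : ℵ₀ ≤ τ) (hK : IsCore K τ)
    (hθ : IsLSC θ) {a : Node X Y} (ha : a.IsValid K θ) {ε : ℝ} (hε : 0 < ε) :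
    ∃ C, a.IsChildren K τ θ ε C := by
  cases haZ : a.Z with
  | none =>
    obtain ⟨C₁, hC₁, h₁, V, hV, hEV, hcov₁⟩ := exists_nodes hθ ha.isOpen_U ha.isOpen_T ha.nonempty
      (E := closure a.U ∩ K) inter_subset_left isOpen_univ (subset_univ _)
      (hK.smallSubcovers.of_isClosed_subset (isClosed_closure.inter hK.isClosed)
        inter_subset_right) none hε
    -- Since `closure O` lies in `V` or outside `closure a.U`, the remainder `closure a.U \ V`
    -- misses `closure O`; thus `Z = Oᶜ` is a closed set off the core containing the other children.
    obtain ⟨O, hO, hKO, hOG⟩ := hK.exists_open_between (V ∪ (closure a.U)ᶜ)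
      (hV.union isClosed_closure.isOpen_compl) (fun x hx => by
        by_cases hxU : x ∈ closure a.U
        · exact Or.inl (hEV ⟨hxU, hx⟩)
        · exact Or.inr hxU)
    have hZ : IsClosed Oᶜ := hO.isClosed_compl
    have hZK : Disjoint Oᶜ K := disjoint_compl_left.mono_right hKO
    obtain ⟨l, hl, hZl⟩ := hK.off _ hZ hZK
    have hEO : closure a.U \ V ⊆ (closure O)ᶜ := fun x hx hxO =>
      (hOG hxO).elim hx.2 fun h => h hx.1
    obtain ⟨C₂, hC₂, h₂, V', -, hEV', hcov₂⟩ := exists_nodes hθ ha.isOpen_U ha.isOpen_T ha.nonempty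
      (E := closure a.U \ V) sdiff_subset isClosed_closure.isOpen_compl hEO
      (hZl.of_isClosed_subset (isClosed_closure.sdiff hV)
        (hEO.trans (compl_subset_compl.2 subset_closure))) (some Oᶜ) hε
    refine ⟨C₁ ∪ C₂, ?_, ?_, ?_, ?_, fun x hx => ?_, fun _ => ⟨?_, ?_, Oᶜ, hZ, hZK, ?_⟩,
      fun Z h => by simp [haZ] at h⟩
    · rintro c (hc | hc)
      · obtain ⟨q1, q2, q3, q4, q5, q6, q7⟩ := h₁ c hc
        exact ⟨q1, q2, q3, fun Z h => by simp [q7] at h⟩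
      · obtain ⟨q1, q2, q3, q4, q5, q6, q7⟩ := h₂ c hc
        refine ⟨q1, q2, q3, fun Z h => ?_⟩
        rw [q7, Option.some.injEq] at h
        subst h
        exact ⟨hZ, hZK, fun x hx hxO => (q4 hx).2 (subset_closure hxO)⟩
    · rintro c (hc | hc)
      exacts [(h₁ c hc).2.2.2.1.trans inter_subset_left,
        (h₂ c hc).2.2.2.1.trans inter_subset_left]
    · rintro c (hc | hc)
      exacts [(h₁ c hc).2.2.2.2.1, (h₂ c hc).2.2.2.2.1]
    · rintro c (hc | hc)
      exacts [(h₁ c hc).2.2.2.2.2.1, (h₂ c hc).2.2.2.2.2.1]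
    · by_cases hxV : x ∈ V
      · exact biUnion_mono subset_union_left (fun _ _ => Subset.rfl) (hcov₁ ⟨hx, hxV⟩)
      · exact biUnion_mono subset_union_right (fun _ _ => Subset.rfl)
          (hcov₂ ⟨hx, hEV' ⟨subset_closure hx, hxV⟩⟩)
    · refine (Cardinal.mk_le_mk_of_subset ?_).trans_lt hC₁
      rintro c ⟨hc | hc, hcZ⟩
      · exact hc
      · simp [(h₂ c hc).2.2.2.2.2.2] at hcZ
    · exact (Cardinal.mk_union_le _ _).trans_lt (Cardinal.add_lt_of_lt hτ
        (hC₁.trans_le (Ordinal.cof_ord_le τ)) (hC₂.trans hl))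
    · rintro c (hc | hc)
      exacts [Or.inl (h₁ c hc).2.2.2.2.2.2, Or.inr (h₂ c hc).2.2.2.2.2.2]
  | some Z =>
    obtain ⟨hZ, hZK, haUZ⟩ := ha.off Z haZ
    obtain ⟨l', hl', hZl'⟩ := hK.off Z hZ hZK
    -- Using the least degree of `Z` makes the number of children smaller than every degree
    -- admissible for `Z`.
    obtain ⟨l, hll', hl, hmin⟩ := hZl'.exists_least
    obtain ⟨C, hC, h, V, -, hEV, hcov⟩ := exists_nodes hθ ha.isOpen_U ha.isOpen_T ha.nonempty
      (E := closure a.U) Subset.rfl isOpen_univ (subset_univ _)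
      (hl.of_isClosed_subset isClosed_closure (hZ.closure_subset_iff.2 haUZ)) (some Z) hε
    refine ⟨C, fun c hc => ?_, fun c hc => (h c hc).2.2.2.1.trans inter_subset_left,
      fun c hc => (h c hc).2.2.2.2.1, fun c hc => (h c hc).2.2.2.2.2.1,
      fun x hx => hcov ⟨hx, hEV (subset_closure hx)⟩, fun h => by simp [haZ] at h,
      fun Z' h' => ?_⟩
    · obtain ⟨q1, q2, q3, q4, q5, q6, q7⟩ := h c hc
      refine ⟨q1, q2, q3, fun Z' h' => ?_⟩
      rw [q7, Option.some.injEq] at h'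
      subst h'
      exact ⟨hZ, hZK, (q4.trans inter_subset_left).trans haUZ⟩
    · rw [haZ, Option.some.injEq] at h'
      subst h'
      exact ⟨fun c hc => (h c hc).2.2.2.2.2.2, fun k hk => hC.trans_le (hmin k hk)⟩

/-- The root of the tree of approximations. -/
def Node.root (X Y : Type u) : Node X Y := ⟨univ, univ, none⟩

theorem Node.isValid_root (hθ : IsSetValued θ) : (Node.root X Y).IsValid K θ where
  isOpen_U := isOpen_univ
  isOpen_T := isOpen_univ
  nonempty x _ := by simpa [Node.root] using hθ x
  off Z h := by simp [Node.root] at h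

/-- A choice of immediate successors for every node at every level. -/
def IsTree (K : Set X) (τ : Cardinal.{u}) (θ : X → Set Y)
    (C : ℕ → Node X Y → Set (Node X Y)) : Prop :=
  ∀ (n : ℕ) (a : Node X Y), a.IsValid K θ → a.IsChildren K τ θ ((1 / 2) ^ n) (C n a)

theorem exists_isTree [RegularSpace X] (hτ : ℵ₀ ≤ τ) (hK : IsCore K τ) (hθ : IsLSC θ) :
    ∃ C, IsTree K τ θ C := by
  have : ∀ (n : ℕ) (a : Node X Y), ∃ C, a.IsValid K θ → a.IsChildren K τ θ ((1 / 2) ^ n) C := by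
    intro n a
    by_cases ha : a.IsValid K θ
    · obtain ⟨C, hC⟩ := ha.exists_children hτ hK hθ (ε := (1 / 2) ^ n) (by positivity)
      exact ⟨C, fun _ => hC⟩
    · exact ⟨∅, fun h => absurd h ha⟩
  choose C hC using this
  exact ⟨C, hC⟩

/-- The infinite branches of a tree of approximations. -/
def IsBranch (C : ℕ → Node X Y → Set (Node X Y)) (s : ℕ → Node X Y) : Prop :=
  s 0 = Node.root X Y ∧ ∀ n, s (n + 1) ∈ C n (s n)

/-- The limits of the branches over a point. -/
def branchLimits (C : ℕ → Node X Y → Set (Node X Y)) (x : X) : Set Y :=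
  {y | ∃ s, IsBranch C s ∧ ∀ n, x ∈ (s n).U ∧ y ∈ closure (s n).T}

variable {C : ℕ → Node X Y → Set (Node X Y)} {s : ℕ → Node X Y}

theorem IsBranch.isValid (hs : IsBranch C s) (hC : IsTree K τ θ C) (hθ : IsSetValued θ) (n : ℕ) :
    (s n).IsValid K θ := by
  induction n with
  | zero => exact hs.1 ▸ Node.isValid_root hθ
  | succ n ih => exact (hC n _ ih).isValid _ (hs.2 n)

theorem IsBranch.antitone_U (hs : IsBranch C s) (hC : IsTree K τ θ C) (hθ : IsSetValued θ) :
    Antitone fun n => (s n).U :=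
  antitone_nat_of_succ_le fun n => (hC n _ (hs.isValid hC hθ n)).subset_U _ (hs.2 n)

theorem IsBranch.antitone_T (hs : IsBranch C s) (hC : IsTree K τ θ C) (hθ : IsSetValued θ) :
    Antitone fun n => (s n).T :=
  antitone_nat_of_succ_le fun n =>
    subset_closure.trans ((hC n _ (hs.isValid hC hθ n)).subset_T _ (hs.2 n))

theorem IsBranch.dist_le (hs : IsBranch C s) (hC : IsTree K τ θ C) (hθ : IsSetValued θ) (n : ℕ)
    {y y' : Y} (hy : y ∈ closure (s (n + 1)).T) (hy' : y' ∈ closure (s (n + 1)).T) :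
    dist y y' ≤ (1 / 2) ^ n :=
  (hC n _ (hs.isValid hC hθ n)).dist_le _ (hs.2 n) y hy y' hy'

theorem IsBranch.exists_limit [CompleteSpace Y] (hs : IsBranch C s) (hC : IsTree K τ θ C)
    (hθ : IsSetValued θ) {x : X} (hx : ∀ n, x ∈ (s n).U) : ∃ y, ∀ n, y ∈ closure (s n).T := by
  choose y hyθ hyT using fun n => (hs.isValid hC hθ n).nonempty x (subset_closure (hx n))
  have hmem : ∀ n m, n ≤ m → y m ∈ (s n).T := fun n m hnm => hs.antitone_T hC hθ hnm (hyT m)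
  -- The shift skips the root, whose range part is all of `Y` and has no diameter bound.
  have hcau : CauchySeq fun n => y (n + 1) := by
    refine cauchySeq_of_le_tendsto_0' (fun n => (1 / 2 : ℝ) ^ n) (fun n m hnm => ?_)
      (tendsto_pow_atTop_nhds_zero_of_lt_one (by norm_num) (by norm_num))
    exact hs.dist_le hC hθ n (subset_closure (hmem _ _ le_rfl))
      (subset_closure (hmem _ _ (by lia)))
  obtain ⟨z, hz⟩ := cauchySeq_tendsto_of_complete hcau
  refine ⟨z, fun n => mem_closure_of_tendsto hz ?_⟩
  filter_upwards [Filter.eventually_ge_atTop n] with m hm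
  exact hmem _ _ (by lia)

/-- A finite branch over `x` is continued by an infinite one. -/
theorem exists_branch (hC : IsTree K τ θ C) (hθ : IsSetValued θ) {m : ℕ} {x : X}
    (h0 : s 0 = Node.root X Y) (hs : ∀ n < m, s (n + 1) ∈ C n (s n)) (hx : ∀ n ≤ m, x ∈ (s n).U) :
    ∃ t, IsBranch C t ∧ t m = s m ∧ ∀ n, x ∈ (t n).U := by
  have hnext : ∀ (n : ℕ) (a : Node X Y), a.IsValid K θ → x ∈ a.U → ∃ c ∈ C n a, x ∈ c.U :=
    fun n a ha hxa => by
      obtain ⟨c, hc, hxc⟩ := mem_iUnion₂.1 ((hC n a ha).cover hxa)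
      exact ⟨c, hc, hxc⟩
  choose! g hgC hgx using hnext
  -- The branch copies `s` up to level `m` and then keeps choosing a child whose `U` contains `x`.
  let t : ℕ → Node X Y := fun n => Nat.rec (s 0)
    (fun k a => if k + 1 ≤ m then s (k + 1) else g k a) n
  have hts : ∀ k, t (k + 1) = if k + 1 ≤ m then s (k + 1) else g k (t k) := fun k => rfl
  have hle : ∀ k ≤ m, t k = s k := by
    rintro (_ | k) hk
    · rfl
    · rw [hts, if_pos hk]
  have hinv : ∀ k, (t k).IsValid K θ ∧ x ∈ (t k).U ∧ t (k + 1) ∈ C k (t k) := by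
    have hstep : ∀ k, (t k).IsValid K θ → x ∈ (t k).U → t (k + 1) ∈ C k (t k) := by
      intro k h1 h2
      rw [hts]
      split_ifs with h
      · rw [hle k (by lia)]
        exact hs k h
      · exact hgC k _ h1 h2
    intro k
    induction k with
    | zero =>
      have h1 : (t 0).IsValid K θ := by
        rw [show t 0 = Node.root X Y from h0]
        exact Node.isValid_root hθ
      exact ⟨h1, hx 0 (Nat.zero_le m), hstep 0 h1 (hx 0 (Nat.zero_le m))⟩
    | succ k ih =>
      have h1 := (hC k _ ih.1).isValid _ ih.2.2
      have h2 : x ∈ (t (k + 1)).U := by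
        rw [hts]
        split_ifs with h
        · exact hx _ h
        · exact hgx k _ ih.1 ih.2.1
      exact ⟨h1, h2, hstep _ h1 h2⟩
  exact ⟨t, ⟨h0, fun k => (hinv k).2.2⟩, hle m le_rfl, fun k => (hinv k).2.1⟩

theorem isSetValued_branchLimits [CompleteSpace Y] (hC : IsTree K τ θ C) (hθ : IsSetValued θ) :
    IsSetValued (branchLimits C) := by
  intro x
  obtain ⟨t, ht, -, htx⟩ := exists_branch (s := fun _ => Node.root X Y) (m := 0) (x := x) hC hθ rfl
    (fun n hn => absurd hn (Nat.not_lt_zero n)) (fun _ _ => mem_univ x)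
  obtain ⟨y, hy⟩ := ht.exists_limit hC hθ htx
  exact ⟨y, t, ht, fun n => ⟨htx n, hy n⟩⟩

theorem branchLimits_subset (hC : IsTree K τ θ C) (hθ : IsSetValued θ)
    (hcl : ∀ x, IsClosed (θ x)) (x : X) : branchLimits C x ⊆ θ x := by
  rintro y ⟨s, hs, hsx⟩
  rw [← (hcl x).closure_eq, Metric.mem_closure_iff]
  intro ε hε
  obtain ⟨n, hn⟩ := exists_pow_lt_of_lt_one hε (by norm_num : (1 / 2 : ℝ) < 1)
  obtain ⟨z, hzθ, hzT⟩ := (hs.isValid hC hθ (n + 1)).nonempty x (subset_closure (hsx _).1)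
  exact ⟨z, hzθ, (hs.dist_le hC hθ n (hsx _).2 (subset_closure hzT)).trans_lt hn⟩

/-- Every point of the open set `(s (n + 1)).U` carries a branch that agrees with `s` at level `n +
1`, so it has a limit within `(1 / 2) ^ n` of the given one. -/
theorem isLSC_branchLimits [CompleteSpace Y] (hC : IsTree K τ θ C) (hθ : IsSetValued θ) :
    IsLSC (branchLimits C) := by
  intro H hH
  refine isOpen_iff_mem_nhds.2 ?_
  rintro x ⟨y, ⟨s, hs, hsx⟩, hyH⟩
  obtain ⟨ε, hε, hεH⟩ := Metric.isOpen_iff.1 hH y hyH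
  obtain ⟨n, hn⟩ := exists_pow_lt_of_lt_one hε (by norm_num : (1 / 2 : ℝ) < 1)
  refine Filter.mem_of_superset
    ((hs.isValid hC hθ (n + 1)).isOpen_U.mem_nhds (hsx _).1) fun x' hx' => ?_
  obtain ⟨t, ht, hts, htx⟩ := exists_branch hC hθ hs.1 (m := n + 1)
    (fun k _ => hs.2 k) (fun k hk => hs.antitone_U hC hθ hk hx')
  obtain ⟨z, hz⟩ := ht.exists_limit hC hθ htx
  refine ⟨z, ⟨t, ht, fun k => ⟨htx k, hz k⟩⟩, hεH ?_⟩
  rw [Metric.mem_ball]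
  exact (hs.dist_le hC hθ n (hts ▸ hz (n + 1)) (hsx _).2).trans_lt hn

end Tree

/-! ### Cardinalities of unions -/

section Counting

variable {α β : Type u} {τ κ : Cardinal.{u}}

theorem card_biUnion_lt (hτ : ℵ₀ ≤ τ) {S : Set α} {f : α → Set β} {b : Cardinal.{u}}
    (hS : #S < τ) (hb : b < τ) (hf : ∀ a ∈ S, #(f a) ≤ b) : #(⋃ a ∈ S, f a : Set β) < τ :=
  (Cardinal.mk_biUnion_le f S).trans_lt
    ((mul_le_mul_right (ciSup_le' fun a : S => hf a a.2) _).trans_lt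
      (Cardinal.mul_lt_of_lt hτ hS hb))

theorem card_biUnion_le (hκ : ℵ₀ ≤ κ) {S : Set α} {f : α → Set β}
    (hS : #S ≤ κ) (hf : ∀ a ∈ S, #(f a) ≤ κ) : #(⋃ a ∈ S, f a : Set β) ≤ κ :=
  (Cardinal.mk_biUnion_le f S).trans ((mul_le_mul' hS (ciSup_le' fun a : S => hf a a.2)).trans
    (Cardinal.mul_eq_self hκ).le)

theorem card_iUnion_nat_le (hκ : ℵ₀ ≤ κ) {A : ℕ → Set α} (hA : ∀ n, #(A n) ≤ κ) :
    #(⋃ n, A n) ≤ κ := by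
  have h : ⋃ n, A n = ⋃ n ∈ (univ : Set (ULift.{u} ℕ)), A n.down := by
    ext x
    simp [ULift.exists]
  rw [h]
  exact card_biUnion_le hκ (by simpa using hκ) fun n _ => hA n.down

theorem exists_bound_of_lt_cof {S : Set α} (hS : #S < τ.ord.cof) {k : α → Cardinal.{u}}
    (hk : ∀ a ∈ S, k a < τ) : ∃ b < τ, ∀ a ∈ S, k a ≤ b :=
  ⟨⨆ a : S, k a, Cardinal.iSup_lt_of_lt_cof_ord hS fun a => hk a a.2, fun a ha =>
    le_ciSup (f := fun a : S => k a) Cardinal.bddAbove_of_small ⟨a, ha⟩⟩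

theorem card_iUnion_nat_lt (hτ : ℵ₀ < τ.ord.cof) {A : ℕ → Set α} (hA : ∀ n, #(A n) < τ) :
    #(⋃ n, A n) < τ := by
  obtain ⟨b, hb, hAb⟩ := exists_bound_of_lt_cof (S := (univ : Set (ULift.{u} ℕ)))
    (k := fun n => #(A n.down)) (by simpa using hτ) (fun n _ => hA n.down)
  exact (card_iUnion_nat_le (le_max_right b ℵ₀)
    fun n => (hAb ⟨n⟩ trivial).trans (le_max_left _ _)).trans_lt
      (max_lt hb (hτ.trans_le (Ordinal.cof_ord_le τ)))

end Counting

/-! ### Small dense sets and total boundedness in metric spaces -/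

section Metric

variable {Y : Type u} [MetricSpace Y] {S M Z : Set Y} {τ : Cardinal.{u}}

theorem card_balls_lt (hτ : ℵ₀ < τ) (hS : #S < τ) :
    #(range fun p : S × ℕ => Metric.ball (p.1 : Y) (1 / ((p.2 : ℝ) + 1))) < τ := by
  refine Cardinal.mk_range_le.trans_lt ?_
  simpa using Cardinal.mul_lt_of_lt hτ.le hS hτ

/-- A radius below half of `ε` leaves room for the distance from `y` to the centre, so the countably
many radii about points of `S` suffice. -/
theorem exists_ball_subset (hMS : M ⊆ closure S) {y : Y} (hy : y ∈ M) {U : Set Y} (hU : U ∈ 𝓝 y) :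
    ∃ p : S × ℕ, y ∈ Metric.ball (p.1 : Y) (1 / ((p.2 : ℝ) + 1)) ∧
      Metric.ball (p.1 : Y) (1 / ((p.2 : ℝ) + 1)) ⊆ U := by
  obtain ⟨ε, hε, hεU⟩ := Metric.mem_nhds_iff.1 hU
  obtain ⟨n, hn⟩ := exists_nat_one_div_lt (half_pos hε)
  obtain ⟨s, hs, hys⟩ := Metric.mem_closure_iff.1 (hMS hy) (1 / ((n : ℝ) + 1)) (by positivity)
  refine ⟨⟨⟨s, hs⟩, n⟩, hys, fun z hz => hεU ?_⟩
  have h1 := Metric.mem_ball.1 hz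
  have h2 := dist_triangle z s y
  rw [dist_comm] at hys
  rw [Metric.mem_ball]
  dsimp only at h1
  linarith

theorem smallSubcovers_of_subset_closure (hτ : ℵ₀ < τ) (hS : #S < τ) (hMS : M ⊆ closure S) :
    SmallSubcovers M τ := by
  refine smallSubcovers_of_refinements fun γ h1 h2 =>
    ⟨(range fun p : S × ℕ => Metric.ball (p.1 : Y) (1 / ((p.2 : ℝ) + 1))) ∩
      {V | ∃ U ∈ γ, V ⊆ U}, fun V hV => hV.2, fun y hy => ?_,
      (Cardinal.mk_le_mk_of_subset inter_subset_left).trans_lt (card_balls_lt hτ hS)⟩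
  obtain ⟨U, hU, hyU⟩ := h2 hy
  obtain ⟨p, hp, hpU⟩ := exists_ball_subset hMS hy ((h1 U hU).mem_nhds hyU)
  exact ⟨_, ⟨⟨p, rfl⟩, U, hU, hpU⟩, hp⟩

theorem weight_lt_of_subset_closure (hτ : ℵ₀ < τ) (hS : #S < τ) (hMS : M ⊆ closure S) :
    weight M < τ := by
  refine lt_of_le_of_lt (csInf_le' ⟨(fun V => ((↑) ⁻¹' V : Set M)) ''
    (range fun p : S × ℕ => Metric.ball (p.1 : Y) (1 / ((p.2 : ℝ) + 1))), ?_, rfl⟩)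
    (Cardinal.mk_image_le.trans_lt (card_balls_lt hτ hS))
  refine TopologicalSpace.isTopologicalBasis_of_isOpen_of_nhds ?_ fun y V hy hV => ?_
  · rintro _ ⟨_, ⟨p, rfl⟩, rfl⟩
    exact Metric.isOpen_ball.preimage continuous_subtype_val
  · obtain ⟨U, hU, rfl⟩ := isOpen_induced_iff.1 hV
    obtain ⟨p, hp, hpU⟩ := exists_ball_subset hMS y.2 (hU.mem_nhds hy)
    exact ⟨_, ⟨_, ⟨p, rfl⟩, rfl⟩, hp, preimage_mono hpU⟩

/-- A closed subset of a complete space has small subcovers if, up to subsets with small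
subcovers, it is totally bounded. -/
theorem smallSubcovers_of_totallyBounded [CompleteSpace Y] (hτ : ℵ₀ ≤ τ) (hZ : IsClosed Z)
    (h : ∀ ε > 0, ∃ 𝒯 : Set (Set Y), 𝒯.Finite ∧ (∀ T ∈ 𝒯, ∀ y ∈ T, ∀ y' ∈ T, dist y y' ≤ ε) ∧
      ∃ M ⊆ Z, SmallSubcovers M τ ∧ Z ⊆ ⋃₀ 𝒯 ∪ M) : SmallSubcovers Z τ := by
  intro γ h1 h2
  by_contra hcon
  -- Sets whose trace on `Z` is covered by fewer than `τ` members of `γ` are negligible, and `f`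
  -- consists of their complements. If `Z` is not negligible, an ultrafilter finer than `f` contains
  -- no negligible set; total boundedness makes it Cauchy, yet the member of `γ` around its limit is
  -- negligible.
  let f : Filter Y := Filter.comk (fun A => ∃ ξ ⊆ γ, A ∩ Z ⊆ ⋃₀ ξ ∧ #ξ < τ)
    ⟨∅, empty_subset _, by simp, by simpa using Cardinal.aleph0_pos.trans_le hτ⟩
    (fun A ⟨ξ, a, b, c⟩ B hBA => ⟨ξ, a, (inter_subset_inter_left _ hBA).trans b, c⟩)
    (fun A ⟨ξ, a, b, c⟩ B ⟨ξ', a', b', c'⟩ => ⟨ξ ∪ ξ', union_subset a a', by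
        rw [union_inter_distrib_right, sUnion_union]
        exact union_subset_union b b',
      (Cardinal.mk_union_le _ _).trans_lt (Cardinal.add_lt_of_lt hτ c c')⟩)
  have hmem : ∀ A : Set Y, Aᶜ ∈ f ↔ ∃ ξ ⊆ γ, A ∩ Z ⊆ ⋃₀ ξ ∧ #ξ < τ := fun A =>
    Filter.compl_mem_comk
  have hne : f.NeBot := by
    refine Filter.neBot_iff.2 fun hbot => hcon ?_
    obtain ⟨ξ, a, b, c⟩ := (hmem univ).1 (by rw [hbot]; exact Filter.mem_bot)
    exact ⟨ξ, a, by rwa [univ_inter] at b, c⟩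
  let 𝒰 := Ultrafilter.of f
  have hf𝒰 : ∀ A : Set Y, (∃ ξ ⊆ γ, A ∩ Z ⊆ ⋃₀ ξ ∧ #ξ < τ) → Aᶜ ∈ 𝒰 := fun A hA =>
    Ultrafilter.of_le f ((hmem A).2 hA)
  have hZ𝒰 : Z ∈ 𝒰 := by
    have := hf𝒰 Zᶜ ⟨∅, empty_subset _, by simp, by simpa using Cardinal.aleph0_pos.trans_le hτ⟩
    rwa [compl_compl] at this
  have hcau : Cauchy (𝒰 : Filter Y) := by
    refine Metric.cauchy_iff.2 ⟨𝒰.neBot, fun ε hε => ?_⟩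
    obtain ⟨𝒯, hfin, hdist, M, hMZ, hM, hcov⟩ := h (ε / 2) (half_pos hε)
    have hM𝒰 : Mᶜ ∈ 𝒰 := by
      obtain ⟨ξ, a, b, c⟩ := hM γ h1 (hMZ.trans h2)
      exact hf𝒰 M ⟨ξ, a, inter_subset_left.trans b, c⟩
    obtain ⟨T, hT, hT𝒰⟩ := (Ultrafilter.finite_sUnion_mem_iff hfin).1
      (Filter.mem_of_superset (Filter.inter_mem hZ𝒰 hM𝒰) fun y hy => (hcov hy.1).resolve_right hy.2)
    exact ⟨T, hT𝒰, fun y hy y' hy' => (hdist T hT y hy y' hy').trans_lt (half_lt_self hε)⟩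
  obtain ⟨y, hy⟩ := CompleteSpace.complete hcau
  obtain ⟨U, hU, hyU⟩ := h2 (isClosed_iff_ultrafilter.1 hZ y 𝒰 hy hZ𝒰)
  have hU𝒰 : U ∈ 𝒰 := hy ((h1 U hU).mem_nhds hyU)
  refine Ultrafilter.compl_mem_iff_notMem.1 (hf𝒰 U ⟨{U}, by simpa using hU, by simp, ?_⟩) hU𝒰
  simpa using Cardinal.one_lt_aleph0.trans_le hτ

end Metric

/-! ### Levels and descendants in the tree -/

section Levels

variable {X Y : Type u} {C : ℕ → Node X Y → Set (Node X Y)} {s : ℕ → Node X Y}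

/-- The nodes that lie `k` levels above a set `D` of nodes of level `n`. -/
def descendants (C : ℕ → Node X Y → Set (Node X Y)) (n : ℕ) (D : Set (Node X Y)) :
    ℕ → Set (Node X Y)
  | 0 => D
  | k + 1 => ⋃ a ∈ descendants C n D k, C (n + k) a

/-- The nodes of a given level. -/
def level (C : ℕ → Node X Y → Set (Node X Y)) : ℕ → Set (Node X Y)
  | 0 => {Node.root X Y}
  | n + 1 => ⋃ a ∈ level C n, C n a

theorem IsBranch.mem_descendants (hs : IsBranch C s) {n : ℕ} {D : Set (Node X Y)} (hn : s n ∈ D)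
    (k : ℕ) : s (n + k) ∈ descendants C n D k := by
  induction k with
  | zero => exact hn
  | succ k ih => exact mem_biUnion ih (hs.2 (n + k))

theorem IsBranch.mem_level (hs : IsBranch C s) (n : ℕ) : s n ∈ level C n := by
  induction n with
  | zero => exact hs.1
  | succ n ih => exact mem_biUnion ih (hs.2 n)

/-- A point in the range part of each of the given nodes. -/
def nodePoints (A : Set (Node X Y)) : Set Y :=
  range fun a : {a // a ∈ A ∧ a.T.Nonempty} => a.2.2.some

theorem card_nodePoints_le (A : Set (Node X Y)) : #(nodePoints A) ≤ #A :=
  Cardinal.mk_range_le.trans (Cardinal.mk_le_mk_of_subset fun _ ha => ha.1)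

end Levels

/-! ### Size of the set of branch limits -/

section CountingBranches

variable {X Y : Type u} [TopologicalSpace X] [MetricSpace Y] {K : Set X} {τ : Cardinal.{u}}
  {θ : X → Set Y} {C : ℕ → Node X Y → Set (Node X Y)} {s : ℕ → Node X Y}

theorem isValid_of_mem_level (hC : IsTree K τ θ C) (hθ : IsSetValued θ) {n : ℕ} :
    ∀ a ∈ level C n, a.IsValid K θ := by
  induction n with
  | zero =>
    rintro a rfl
    exact Node.isValid_root hθ
  | succ n ih =>
    intro c hc
    obtain ⟨a, ha, hca⟩ := mem_iUnion₂.1 hc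
    exact (hC n a (ih a ha)).isValid c hca

/-- The three bounds support each other in the induction. Core nodes have only core ancestors, so
regularity of `cof τ` keeps them below `cof τ`; over so few nodes, the numbers of children and the
degrees of the new sets `Z` stay bounded below `τ`. Off nodes inherit their `Z` and bring no new
degrees. -/
theorem card_level (hτ : ℵ₀ ≤ τ) (hK : IsCore K τ) (hC : IsTree K τ θ C) (hθ : IsSetValued θ)
    (n : ℕ) : #{a ∈ level C n | a.Z = none} < τ.ord.cof ∧ #(level C n) < τ ∧
      ∃ l < τ, ∀ a ∈ level C n, ∀ Z, a.Z = some Z → SmallSubcovers Z l := by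
  have hreg := isRegular_cof_ord hτ
  induction n with
  | zero =>
    have h1 : #(level C 0) ≤ 1 := (Cardinal.mk_singleton _).le
    have h2 : (1 : Cardinal.{u}) < τ.ord.cof := Cardinal.one_lt_aleph0.trans_le hreg.aleph0_le
    refine ⟨((Cardinal.mk_le_mk_of_subset (sep_subset _ _)).trans h1).trans_lt h2,
      h1.trans_lt (h2.trans_le (Ordinal.cof_ord_le τ)), 0, Cardinal.aleph0_pos.trans_le hτ, ?_⟩
    rintro a rfl Z hZ
    simp [Node.root] at hZ
  | succ n ih =>
    obtain ⟨hcore, hcard, l, hl, hoff⟩ := ih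
    have hch : ∀ a ∈ level C n, a.IsChildren K τ θ ((1 / 2) ^ n) (C n a) := fun a ha =>
      hC n a (isValid_of_mem_level hC hθ a ha)
    refine ⟨?_, ?_, ?_⟩
    · refine (Cardinal.mk_le_mk_of_subset ?_).trans_lt
        ((Cardinal.card_biUnion_lt_iff_forall_of_isRegular hreg hcore
          (t := fun a _ => {c ∈ C n a | c.Z = none})).2
          fun a ha => ((hch a ha.1).core ha.2).1)
      rintro c ⟨hc, hcZ⟩
      obtain ⟨a, ha, hca⟩ := mem_iUnion₂.1 hc
      refine mem_biUnion (x := a) ⟨ha, ?_⟩ ⟨hca, hcZ⟩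
      cases haZ : a.Z with
      | none => rfl
      | some Z =>
        have := ((hch a ha).off Z haZ).1 c hca
        simp [hcZ] at this
    · obtain ⟨b, hb, hbC⟩ := exists_bound_of_lt_cof hcore (k := fun a => #(C n a))
        (fun a ha => ((hch a ha.1).core ha.2).2.1)
      refine card_biUnion_lt hτ hcard (max_lt hb hl) fun a ha => ?_
      cases haZ : a.Z with
      | none => exact (hbC a ⟨ha, haZ⟩).trans (le_max_left _ _)
      | some Z =>
        exact (((hch a ha).off Z haZ).2 l (hoff a ha Z haZ)).le.trans (le_max_right _ _)
    · have hex : ∀ a ∈ {a ∈ level C n | a.Z = none}, ∃ k < τ, ∀ c ∈ C n a, ∀ Z, c.Z = some Z →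
          SmallSubcovers Z k := by
        rintro a ⟨ha, haZ⟩
        obtain ⟨-, -, Z, hZ, hZK, hcZ⟩ := (hch a ha).core haZ
        obtain ⟨k, hk, hs⟩ := hK.off Z hZ hZK
        refine ⟨k, hk, fun c hc Z' hZ' => ?_⟩
        rcases hcZ c hc with h | h
        · simp [h] at hZ'
        · rw [h, Option.some.injEq] at hZ'
          exact hZ' ▸ hs
      choose! k hk hks using hex
      obtain ⟨b, hb, hkb⟩ := exists_bound_of_lt_cof hcore hk
      refine ⟨max b l, max_lt hb hl, fun c hc Z hcZ => ?_⟩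
      obtain ⟨a, ha, hca⟩ := mem_iUnion₂.1 hc
      cases haZ : a.Z with
      | none => exact (hks a ⟨ha, haZ⟩ c hca Z hcZ).mono ((hkb a ⟨ha, haZ⟩).trans (le_max_left _ _))
      | some Z' =>
        have := ((hch a ha).off Z' haZ).1 c hca
        rw [hcZ, Option.some.injEq] at this
        exact (hoff a ha Z (this ▸ haZ)).mono (le_max_right _ _)

/-- Because `Z` is inherited, the bound `κ` does not grow with the level; this lets all descendants
be collected even when `cof τ = ℵ₀`. -/
theorem card_descendants_le (hC : IsTree K τ θ C) {n : ℕ} {D : Set (Node X Y)}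
    {l κ : Cardinal.{u}} (hκ : ℵ₀ ≤ κ) (hl : l ≤ κ) (hD : #D ≤ κ)
    (hDl : ∀ a ∈ D, a.IsValid K θ ∧ ∃ Z, a.Z = some Z ∧ SmallSubcovers Z l) (k : ℕ) :
    #(descendants C n D k) ≤ κ ∧
      ∀ a ∈ descendants C n D k, a.IsValid K θ ∧ ∃ Z, a.Z = some Z ∧ SmallSubcovers Z l := by
  induction k with
  | zero => exact ⟨hD, hDl⟩
  | succ k ih =>
    refine ⟨card_biUnion_le hκ ih.1 fun a ha => ?_, fun c hc => ?_⟩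
    · obtain ⟨hv, Z, hZ, hs⟩ := ih.2 a ha
      exact (((hC _ a hv).off Z hZ).2 l hs).le.trans hl
    · obtain ⟨a, ha, hca⟩ := mem_iUnion₂.1 hc
      obtain ⟨hv, Z, hZ, hs⟩ := ih.2 a ha
      exact ⟨(hC _ a hv).isValid c hca, Z, ((hC _ a hv).off Z hZ).1 c hca, hs⟩

theorem IsBranch.mem_closure_nodePoints (hs : IsBranch C s) (hC : IsTree K τ θ C)
    (hθ : IsSetValued θ) {A : Set (Node X Y)} {N : ℕ} (hA : ∀ n, N ≤ n → s n ∈ A) {y : Y}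
    (hy : ∀ n, y ∈ closure (s n).T) : y ∈ closure (nodePoints A) := by
  rw [Metric.mem_closure_iff]
  intro ε hε
  obtain ⟨n, hn⟩ := exists_pow_lt_of_lt_one hε (by norm_num : (1 / 2 : ℝ) < 1)
  have hne : (s (N + n + 1)).T.Nonempty := closure_nonempty_iff.1 ⟨y, hy _⟩
  refine ⟨_, ⟨⟨s (N + n + 1), hA _ (by lia), hne⟩, rfl⟩, ?_⟩
  refine (hs.dist_le hC hθ (N + n) (hy _) (subset_closure hne.some_mem)).trans_lt
    (lt_of_le_of_lt ?_ hn)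
  exact pow_le_pow_of_le_one (by norm_num) (by norm_num) (by lia)

theorem exists_dense_branchLimits (hτ : ℵ₀ < τ.ord.cof) (hK : IsCore K τ) (hC : IsTree K τ θ C)
    (hθ : IsSetValued θ) : ∃ S : Set Y, #S < τ ∧ image (branchLimits C) ⊆ closure S := by
  refine ⟨nodePoints (⋃ n, level C n), (card_nodePoints_le _).trans_lt (card_iUnion_nat_lt hτ
    fun n => (card_level (hτ.le.trans (Ordinal.cof_ord_le τ)) hK hC hθ n).2.1), ?_⟩
  refine iUnion_subset fun x => ?_
  rintro y ⟨s, hs, hsx⟩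
  exact hs.mem_closure_nodePoints hC hθ (N := 0)
    (fun n _ => mem_iUnion.2 ⟨n, hs.mem_level n⟩) fun n => (hsx n).2

/-- At level `n` a branch passes either through one of finitely many core nodes or through an off
node. In the second case its limit lies in the closure of the points chosen for descendants of off
nodes, of which there are fewer than `τ`. -/
theorem exists_finite_cover_branchLimits (hτ : ℵ₀ ≤ τ) (hcof : τ.ord.cof ≤ ℵ₀) (hK : IsCore K τ)
    (hC : IsTree K τ θ C) (hθ : IsSetValued θ) (n : ℕ) :
    ∃ A : Set (Node X Y), A.Finite ∧ A ⊆ level C n ∧ ∃ S : Set Y, SmallSubcovers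
      (closure (image (branchLimits C)) ∩ closure S) τ ∧
      image (branchLimits C) ⊆ (⋃ a ∈ A, closure a.T) ∪ closure S := by
  obtain ⟨hcore, hcard, l, hl, hoff⟩ := card_level hτ hK hC hθ n
  -- For `τ = ℵ₀` the whole level is finite and no exceptional set is needed; the argument by a
  -- dense set requires `ℵ₀ < τ`.
  rcases hτ.eq_or_lt with rfl | hlt
  · refine ⟨level C n, Cardinal.lt_aleph0_iff_set_finite.1 hcard, Subset.rfl, ∅,
      fun γ _ _ => ⟨∅, empty_subset _, by simp, by simpa using Cardinal.aleph0_pos⟩, iUnion_subset fun x => ?_⟩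
    rintro y ⟨s, hs, hsx⟩
    exact Or.inl (mem_biUnion (hs.mem_level n) (hsx n).2)
  · set D := {a ∈ level C n | a.Z ≠ none}
    set κ := max (max ℵ₀ l) #D
    have hκ : κ < τ := max_lt (max_lt hlt hl)
      ((Cardinal.mk_le_mk_of_subset (sep_subset _ _)).trans_lt hcard)
    have hdesc := card_descendants_le hC (n := n) (D := D) (l := l) (κ := κ)
      ((le_max_left _ _).trans (le_max_left _ _)) ((le_max_right _ _).trans (le_max_left _ _))
      (le_max_right _ _) (fun a ha => by
        obtain ⟨Z, hZ⟩ := Option.ne_none_iff_exists'.1 ha.2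
        exact ⟨isValid_of_mem_level hC hθ a ha.1, Z, hZ, hoff a ha.1 Z hZ⟩)
    refine ⟨{a ∈ level C n | a.Z = none},
      Cardinal.lt_aleph0_iff_set_finite.1 (hcore.trans_le hcof), sep_subset _ _,
      nodePoints (⋃ k, descendants C n D k), smallSubcovers_of_subset_closure hlt
      ((card_nodePoints_le _).trans_lt ((card_iUnion_nat_le
        ((le_max_left _ _).trans (le_max_left _ _)) fun k => (hdesc k).1).trans_lt hκ))
      inter_subset_right, iUnion_subset fun x => ?_⟩
    rintro y ⟨s, hs, hsx⟩
    by_cases hZ : (s n).Z = none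
    · exact Or.inl (mem_biUnion (x := s n) ⟨hs.mem_level n, hZ⟩ (hsx n).2)
    · refine Or.inr (hs.mem_closure_nodePoints hC hθ (N := n) (fun m hm => ?_)
        fun n => (hsx n).2)
      obtain ⟨k, rfl⟩ := Nat.exists_eq_add_of_le hm
      exact mem_iUnion.2 ⟨k, hs.mem_descendants (D := D) ⟨hs.mem_level n, hZ⟩ k⟩

theorem smallSubcovers_closure_branchLimits [CompleteSpace Y] (hτ : ℵ₀ ≤ τ) (hK : IsCore K τ)
    (hC : IsTree K τ θ C) (hθ : IsSetValued θ) :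
    SmallSubcovers (closure (image (branchLimits C))) τ := by
  rcases lt_or_ge ℵ₀ τ.ord.cof with hcof | hcof
  · obtain ⟨S, hS, hsub⟩ := exists_dense_branchLimits hcof hK hC hθ
    exact smallSubcovers_of_subset_closure (hcof.trans_le (Ordinal.cof_ord_le τ)) hS
      (closure_minimal hsub isClosed_closure)
  · refine smallSubcovers_of_totallyBounded hτ isClosed_closure fun ε hε => ?_
    obtain ⟨n, hn⟩ := exists_pow_lt_of_lt_one hε (by norm_num : (1 / 2 : ℝ) < 1)
    obtain ⟨A, hA, hAl, S, hS, hcov⟩ :=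
      exists_finite_cover_branchLimits hτ hcof hK hC hθ (n + 1)
    refine ⟨(fun a => closure a.T) '' A, hA.image _, ?_, _, inter_subset_left, hS, fun y hy => ?_⟩
    · rintro _ ⟨c, hc, rfl⟩ y hy y' hy'
      obtain ⟨a, ha, hca⟩ := mem_iUnion₂.1 (hAl hc)
      exact ((hC n a (isValid_of_mem_level hC hθ a ha)).dist_le c hca y hy y' hy').trans hn.le
    -- Finiteness of `A` makes the cover closed, so it extends from the image to its closure.
    · have hcl : IsClosed ((⋃ a ∈ A, closure a.T) ∪ closure S) :=
        (hA.isClosed_biUnion fun _ _ => isClosed_closure).union isClosed_closure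
      rw [sUnion_image]
      exact (closure_minimal hcov hcl hy).imp id fun h => ⟨hy, h⟩

end CountingBranches

/-- Otherwise a cofinal family of cardinals below `τ` can be enumerated by `ℕ`. Its supremum is `τ`
because `τ`, being `ℵ₀` or singular, is a limit cardinal. -/
theorem aleph0_lt_cof_of_not_isSequential {τ : Cardinal.{u}} (hτ : ℵ₀ ≤ τ)
    (h : ¬ IsSequential τ) : ℵ₀ < τ.ord.cof := by
  refine lt_of_le_of_ne (isRegular_cof_ord hτ).aleph0_le fun hcof => h ?_
  have hsucc : ∀ b < τ, Order.succ b < τ := by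
    intro b hb
    rcases Cardinal.isRegular_or_isSingular hτ with hr | hs
    · rw [← hr.cof_ord, ← hcof] at hb ⊢
      exact Cardinal.isSuccLimit_aleph0.succ_lt hb
    · exact hs.isSuccLimit.succ_lt hb
  obtain ⟨I, c, hI, hc, hb⟩ := exists_cofinal_cardinals τ
  rw [← hcof] at hI
  obtain ⟨_⟩ := Cardinal.denumerable_iff.2 hI
  let e := Denumerable.eqv I
  refine ⟨fun n => c (e.symm n), fun n => hc _, ?_, fun b hbu => not_lt.1 fun hbτ => ?_⟩
  · rintro _ ⟨n, rfl⟩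
    exact (hc _).le
  · obtain ⟨i, hi⟩ := hb _ (hsucc b hbτ)
    have : c i ≤ b := hbu ⟨e i, by simp⟩
    exact absurd (hi.trans this) (not_le.2 (Order.lt_succ b))

/-! ### Deduction of the individual assertions -/

section Properties

variable {X : Type u} [TopologicalSpace X] {K : Set X} {τ : Cardinal.{u}}

theorem k1_of_smallSubcovers (h : SmallSubcovers (univ : Set X) τ) : K1 X τ := by
  refine (compactnessDegree_le_iff X τ).2 fun γ h1 h2 => ?_
  obtain ⟨ξ, a, b, c⟩ := h γ h1 h2.ge
  exact ⟨ξ, fun V hV => h1 V (a hV), univ_subset_iff.1 b, fun V hV => ⟨V, a hV, Subset.rfl⟩, c⟩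

theorem k8_of_smallSubcovers (h : SmallSubcovers (univ : Set X) τ) : K8 X τ := fun γ h1 h2 => by
  obtain ⟨ξ, a, b, c⟩ := h γ h1 h2.ge
  exact ⟨ξ, a, univ_subset_iff.1 b, c⟩

theorem k2_of_isCore [T3Space X] (hτ : ℵ₀ ≤ τ) (hK : IsCore K τ) : K2 X τ := by
  intro Y _ _ θ hθ hlsc hcl
  let _ := TopologicalSpace.upgradeIsCompletelyMetrizable Y
  obtain ⟨C, hC⟩ := exists_isTree hτ hK hlsc
  exact ⟨branchLimits C, ⟨isSetValued_branchLimits hC hθ, branchLimits_subset hC hθ hcl⟩,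
    isLSC_branchLimits hC hθ, smallSubcovers_iff_compactnessDegree_le.1
      (smallSubcovers_closure_branchLimits hτ hK hC hθ)⟩

theorem k11_of_isCore [T3Space X] (hτ : ℵ₀ < τ.ord.cof) (hK : IsCore K τ) : K11 X τ := by
  intro Y _ _ θ hθ hlsc hcl
  let _ := TopologicalSpace.upgradeIsCompletelyMetrizable Y
  have hτ' := hτ.trans_le (Ordinal.cof_ord_le τ)
  obtain ⟨C, hC⟩ := exists_isTree hτ'.le hK hlsc
  obtain ⟨S, hS, hsub⟩ := exists_dense_branchLimits hτ hK hC hθ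
  exact ⟨branchLimits C, ⟨isSetValued_branchLimits hC hθ, branchLimits_subset hC hθ hcl⟩,
    isLSC_branchLimits hC hθ, weight_lt_of_subset_closure hτ' hS hsub⟩

theorem K2.k3 (h : K2 X τ) : K3 X τ := by
  intro Y _ _ θ hθ hlsc hcl
  obtain ⟨φ, hφ, -, hk⟩ := h Y θ hθ hlsc hcl
  exact ⟨φ, hφ, hk⟩

theorem K3.k4 (h : K3 X τ) : K4 X τ := by
  intro Y _ _ θ hθ hlsc hcl
  obtain ⟨φ, ⟨hne, hsub⟩, hk⟩ := h Y θ hθ hlsc hcl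
  choose g hg using hne
  refine ⟨g, fun x => hsub x (hg x), smallSubcovers_iff_compactnessDegree_le.1 ?_⟩
  refine (smallSubcovers_iff_compactnessDegree_le.2 hk).of_isClosed_subset isClosed_closure
    (closure_mono ?_)
  rintro _ ⟨x, rfl⟩
  exact mem_iUnion.2 ⟨x, hg x⟩

/-- With one value `y x` chosen at each point, the open sets where `θ` takes the value `y x` cover
`X`; few of them suffice, and `θ` is cut down to the corresponding values. -/
theorem k5_of_smallSubcovers (h : SmallSubcovers (univ : Set X) τ) : K5 X τ := by
  intro Y _ _ θ hθ hlsc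
  choose y hy using hθ
  obtain ⟨P, -, hP, hcov⟩ := h.exists_points (fun x => {z | (θ z ∩ {y x}).Nonempty})
    (fun x _ => ⟨hlsc _ (isOpen_discrete _), ⟨y x, hy x, rfl⟩⟩)
  refine ⟨fun x => θ x ∩ y '' P, ⟨fun x => ?_, fun x => inter_subset_left⟩, fun H _ => ?_, ?_⟩
  · obtain ⟨p, hp, z, hz, rfl⟩ := mem_iUnion₂.1 (hcov (mem_univ x))
    exact ⟨y p, hz, p, hp, rfl⟩
  · simpa only [inter_assoc] using hlsc (y '' P ∩ H) (isOpen_discrete _)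
  · exact (Cardinal.mk_le_mk_of_subset (iUnion_subset fun x => inter_subset_right)).trans_lt
      (Cardinal.mk_image_le.trans_lt hP)

theorem K5.k6 (h : K5 X τ) : K6 X τ := by
  intro Y _ _ θ hθ hlsc
  obtain ⟨φ, hφ, -, hk⟩ := h Y θ hθ hlsc
  exact ⟨φ, hφ, hk⟩

theorem K6.k7 (h : K6 X τ) : K7 X τ := by
  intro Y _ _ θ hθ hlsc
  obtain ⟨φ, ⟨hne, hsub⟩, hk⟩ := h Y θ hθ hlsc
  choose g hg using hne
  refine ⟨g, fun x => hsub x (hg x), (Cardinal.mk_le_mk_of_subset ?_).trans_lt hk⟩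
  rintro _ ⟨x, rfl⟩
  exact mem_iUnion.2 ⟨x, hg x⟩

end Properties

end Selections

theorem theorem2p7 (X : Type u) [TopologicalSpace X] [T3Space X] (F : Set X)
    (τ : Cardinal.{u}) (hτ : ℵ₀ ≤ τ)
    (hF : Selections.ParacompactIn F)
    (hkF : Selections.compactnessDegree F ≤ τ)
    (hY : ∀ Y : Set X, IsClosed Y → Y ⊆ Fᶜ → Selections.compactnessDegree Y < τ) :
    List.TFAE [Selections.K1 X τ, Selections.K2 X τ, Selections.K3 X τ, Selections.K4 X τ,
      Selections.K5 X τ, Selections.K6 X τ, Selections.K7 X τ, Selections.K8 X τ] ∧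
    (¬ Selections.IsSequential τ →
      List.TFAE [Selections.K1 X τ, Selections.K2 X τ, Selections.K3 X τ, Selections.K4 X τ,
        Selections.K5 X τ, Selections.K6 X τ, Selections.K7 X τ, Selections.K8 X τ,
        Selections.K11 X τ]) := by
  open Selections in
  have hoff : ∀ Z : Set X, IsClosed Z → Disjoint Z F → ∃ l < τ, SmallSubcovers Z l :=
    fun Z hZ hZF => smallSubcovers_of_compactnessDegree_lt (hY Z hZ hZF.subset_compl_right)
  -- The hypotheses on `F` and on closed sets off `F` yield K1 with no further assumption.
  have hX : Selections.SmallSubcovers (univ : Set X) τ :=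
    (Selections.smallSubcovers_iff_compactnessDegree_le.2 hkF).of_off hτ isClosed_univ
      (fun Z _ => hoff Z) (subset_univ _)
  obtain ⟨K, hK⟩ := Selections.exists_isCore hτ hX hF hoff
  have h1 := Selections.k1_of_smallSubcovers hX
  have h2 := Selections.k2_of_isCore hτ hK
  have h3 := h2.k3
  have h4 := h3.k4
  have h5 := Selections.k5_of_smallSubcovers hX
  have h6 := h5.k6
  have h7 := h6.k7
  have h8 := Selections.k8_of_smallSubcovers hX
  -- All assertions hold, hence each is equivalent to `True`.
  refine ⟨List.tfae_of_forall True _ (by simp [*]), fun hseq => ?_⟩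
  have h11 := Selections.k11_of_isCore (Selections.aleph0_lt_cof_of_not_isSequential hτ hseq) hK
  exact List.tfae_of_forall True _ (by simp [*])
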